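/- Let $d\ge 1$ be a fixed integer. For an integer $n\ge 1$ let $X=[n]^d$, and call $S\subseteq X$ an *axial assignment* if $S$ meets each axis-parallel hyperplane $\{x\in X: x_i=a\}$ ($i\in[d]$, $a\in[n]$) in exactly one point. Let $(\xi_x)_{x\in X}$ be independent random weights, each exponentially distributed with rate $1$, and put $$Z_d^A(n)=\mathbb{E}\Big[\min_{S}\ \sum_{x\in S}\xi_x\Big],$$ where $S$ ranges over all axial assignments in $X$. Then $$Z_d^A(n)=\Theta\big(n^{-(d-2)}\big);$$ that is, there are constants $c,C>0$ depending only on $d$ such that $c\,n^{-(d-2)}\le Z_d^A(n)\le C\,n^{-(d-2)}$ for all $n\ge 1$ (and in particular the expectation is finite). -/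

import Mathlib

open MeasureTheory ProbabilityTheory

/-- A set `S` of points of the cube `[n]^d` is an axial assignment if it meets every axis-parallel
hyperplane `{x : x i = a}` in exactly one point. -/
def IsAxialAssignment {d n : ℕ} (S : Finset (Fin d → Fin n)) : Prop :=
  ∀ (i : Fin d) (a : Fin n), ∃! x : Fin d → Fin n, x ∈ S ∧ x i = a

open Classical in
/-- The finite set of all axial assignments in `[n]^d`. -/
noncomputable def axialAssignments (d n : ℕ) : Finset (Finset (Fin d → Fin n)) :=
  Finset.univ.filter IsAxialAssignment

/-- The diagonal is an axial assignment, so the minimum below is over a nonempty set. -/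
theorem axialAssignments_nonempty (d n : ℕ) : (axialAssignments d n).Nonempty := by
  classical
  refine ⟨Finset.univ.image (fun (a : Fin n) (_ : Fin d) => a), ?_⟩
  simp only [axialAssignments, Finset.mem_filter, Finset.mem_univ, true_and]
  intro i a
  refine ⟨fun _ => a, ⟨by simp, rfl⟩, ?_⟩
  rintro x ⟨hx, rfl⟩
  obtain ⟨b, -, rfl⟩ := Finset.mem_image.1 hx
  rfl

/-- The minimum total weight of an axial assignment, for the weights `w` on `[n]^d`. -/
noncomputable def minAxialWeight {d n : ℕ} (w : (Fin d → Fin n) → ℝ) : ℝ :=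
  (axialAssignments d n).inf' (axialAssignments_nonempty d n) (fun S => ∑ x ∈ S, w x)

/-! Write d = k + 1. For the lower bound, the weights on a hyperplane `x 0 = a` all exceed n^(-k)
with probability at least 1/e, and an assignment pays for one point in each of the n such
hyperplanes.

For the upper bound, graphs of k-tuples of permutations form a spread family with κ = (n/e)^k
(`isSpreadFamily_axialGraph`). Any spread family of sets of size at most r has, with good
probability, a member of weight O(r/κ) (`expPi_real_heavySet_le`). The proof splits each weight into
a minimum of two independent scaled exponentials. The first copy yields a random set of cheap
points; modulo these, most members shrink to fragments of at most half the size
(`sum_card_large_fragment_le`), and the second copy handles the fragments by induction. The costs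
form a geometric series, so no logarithm is lost. The same splitting makes the tail geometric, which
bounds the mean. -/

/-! ### Exponential weights and their splitting -/

instance isProbabilityMeasure_expMeasure_one : IsProbabilityMeasure (expMeasure 1) :=
  isProbabilityMeasure_expMeasure one_pos

theorem expMeasure_one_real_Ioi (t : ℝ) :
    (expMeasure 1).real (Set.Ioi t) = Real.exp (-(max t 0)) := by
  have h : (expMeasure 1).real (Set.Iic t) = if 0 ≤ t then 1 - Real.exp (-(1 * t)) else 0 := by
    rw [← cdf_eq_real, cdf_expMeasure_eq one_pos]
  rw [← Set.compl_Iic, probReal_compl_eq_one_sub measurableSet_Iic, h]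
  split_ifs with ht
  · simp [ht]
  · simp [(not_le.1 ht).le]

theorem expMeasure_one_Iio_zero : expMeasure 1 (Set.Iio 0) = 0 := by
  have h : (expMeasure 1).real (Set.Iic 0) = 0 := by
    rw [← cdf_eq_real, cdf_expMeasure_eq one_pos]
    simp
  exact measure_mono_null Set.Iio_subset_Iic_self ((measureReal_eq_zero_iff).1 h)

/-- An exponential variable of rate one is the minimum of two independent exponential variables of
rates `q` and `1 - q`. -/
theorem measurePreserving_min_div {q : ℝ} (hq0 : 0 < q) (hq1 : q < 1) :
    MeasurePreserving (fun y : ℝ × ℝ => min (y.1 / q) (y.2 / (1 - q)))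
      ((expMeasure 1).prod (expMeasure 1)) (expMeasure 1) := by
  have hm : Measurable (fun y : ℝ × ℝ => min (y.1 / q) (y.2 / (1 - q))) := by fun_prop
  have hq' : 0 < 1 - q := by linarith
  refine ⟨hm, ?_⟩
  have : IsProbabilityMeasure (((expMeasure 1).prod (expMeasure 1)).map
      (fun y : ℝ × ℝ => min (y.1 / q) (y.2 / (1 - q)))) :=
    Measure.isProbabilityMeasure_map hm.aemeasurable
  refine Measure.ext_of_Iic _ _ fun t => ?_
  rw [← Set.compl_Ioi, prob_compl_eq_one_sub measurableSet_Ioi,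
    prob_compl_eq_one_sub measurableSet_Ioi]
  congr 1
  rw [Measure.map_apply hm measurableSet_Ioi]
  have hpre : (fun y : ℝ × ℝ => min (y.1 / q) (y.2 / (1 - q))) ⁻¹' Set.Ioi t =
      Set.Ioi (t * q) ×ˢ Set.Ioi (t * (1 - q)) := by
    ext y
    simp [lt_div_iff₀, hq0, hq']
  rw [hpre, Measure.prod_prod, ← ENNReal.toReal_eq_toReal_iff' (by finiteness) (by finiteness),
    ENNReal.toReal_mul]
  simp only [← measureReal_def, expMeasure_one_real_Ioi]
  rw [← Real.exp_add]
  congr 1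
  rcases le_total 0 t with ht | ht
  · rw [max_eq_left (by positivity), max_eq_left (by positivity), max_eq_left ht]
    ring
  · rw [max_eq_right (mul_nonpos_of_nonpos_of_nonneg ht hq0.le),
      max_eq_right (mul_nonpos_of_nonpos_of_nonneg ht hq'.le), max_eq_right ht]
    ring

/-- The law of a family of independent exponential variables of rate one. -/
noncomputable def expPi (X : Type*) [Fintype X] : Measure (X → ℝ) :=
  Measure.pi fun _ => expMeasure 1

instance isProbabilityMeasure_expPi (X : Type*) [Fintype X] : IsProbabilityMeasure (expPi X) :=
  inferInstanceAs (IsProbabilityMeasure (Measure.pi fun _ : X => expMeasure 1))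

theorem ae_expPi_nonneg (X : Type*) [Fintype X] : ∀ᵐ w ∂expPi X, ∀ x, 0 ≤ w x := by
  rw [ae_all_iff]
  intro x
  have h : ∀ᵐ y ∂expMeasure 1, 0 ≤ y := by
    rw [ae_iff]
    simpa [Set.Iio] using! expMeasure_one_Iio_zero
  exact (measurePreserving_eval (fun _ : X => expMeasure 1) x).quasiMeasurePreserving.ae h

/-- The minimum of the scaled families `η / q` and `ζ / (1 - q)`. -/
noncomputable def minSplit {X : Type*} (q : ℝ) (y : (X → ℝ) × (X → ℝ)) : X → ℝ :=
  fun x => min (y.1 x / q) (y.2 x / (1 - q))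

theorem measurePreserving_minSplit (X : Type*) [Fintype X] {q : ℝ} (hq0 : 0 < q) (hq1 : q < 1) :
    MeasurePreserving (minSplit q) ((expPi X).prod (expPi X)) (expPi X) := by
  have h1 := (measurePreserving_arrowProdEquivProdArrow ℝ ℝ X (fun _ => expMeasure 1)
    (fun _ => expMeasure 1)).symm
  have h2 := measurePreserving_pi (fun _ : X => (expMeasure 1).prod (expMeasure 1))
    (fun _ : X => expMeasure 1) (fun _ => measurePreserving_min_div hq0 hq1)
  exact h2.comp h1

/-! ### Spread families and minimal fragments -/

open Finset in
/-- The indexed family `f` of finite sets, restricted to the indices in `I`, is spread: for every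
`U`, at most `M / κ ^ #U` of its members contain `U`. -/
def IsSpreadFamily {ι X : Type*} [DecidableEq X] (I : Finset ι) (f : ι → Finset X) (κ M : ℝ) :
    Prop :=
  ∀ U : Finset X, (#{i ∈ I | U ⊆ f i} : ℝ) ≤ (κ⁻¹) ^ #U * M

section Fragment
open Finset
variable {ι X : Type*} [DecidableEq X]

/-- Given `A`, every index `i` has an index `φ A i` whose set lies in `A ∪ f i` and has the fewest
points outside `A`. -/
theorem exists_minimal_fragment (I : Finset ι) (f : ι → Finset X) :
    ∃ φ : Finset X → ι → ι, ∀ A, ∀ i ∈ I, φ A i ∈ I ∧ f (φ A i) ⊆ A ∪ f i ∧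
      ∀ j ∈ I, f j ⊆ A ∪ f i → #(f (φ A i) \ A) ≤ #(f j \ A) := by
  have h : ∀ (A : Finset X) (i : ι), ∃ k, i ∈ I → k ∈ I ∧ f k ⊆ A ∪ f i ∧
      ∀ j ∈ I, f j ⊆ A ∪ f i → #(f k \ A) ≤ #(f j \ A) := by
    intro A i
    by_cases hi : i ∈ I
    · obtain ⟨k, hk, hmin⟩ := exists_min_image {j ∈ I | f j ⊆ A ∪ f i} (fun j => #(f j \ A))
        ⟨i, by simp [hi]⟩
      rw [mem_filter] at hk
      exact ⟨k, fun _ => ⟨hk.1, hk.2, fun j hj hj' => hmin j (by simp [hj, hj'])⟩⟩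
    · exact ⟨i, fun h => absurd h hi⟩
  choose φ hφ using h
  exact ⟨φ, hφ⟩

/-- `E Z` depends on `Z` alone, so when a fragment is known to lie in `E Z`, it has at most `2 ^ r`
possible values. -/
theorem exists_selection_of_subset (I : Finset ι) (f : ι → Finset X) {r : ℕ}
    (hr : ∀ i ∈ I, #(f i) ≤ r) :
    ∃ E : Finset X → Finset X, ∀ Z, #(E Z) ≤ r ∧
      ∀ i ∈ I, f i ⊆ Z → ∃ j ∈ I, E Z = f j ∧ f j ⊆ Z := by
  have h : ∀ Z : Finset X, ∃ F : Finset X, #F ≤ r ∧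
      ∀ i ∈ I, f i ⊆ Z → ∃ j ∈ I, F = f j ∧ f j ⊆ Z := by
    intro Z
    by_cases hZ : ∃ j ∈ I, f j ⊆ Z
    · obtain ⟨j, hj, hjZ⟩ := hZ
      exact ⟨f j, hr j hj, fun _ _ _ => ⟨j, hj, rfl, hjZ⟩⟩
    · exact ⟨∅, by simp, fun i hi hiZ => absurd ⟨i, hi, hiZ⟩ hZ⟩
  choose E hE using h
  exact ⟨E, hE⟩

/-- For a random set `A` with law `m`, few indices of a spread family have a large minimal
fragment. -/
theorem sum_card_large_fragment_le [Fintype X] {I : Finset ι} {f : ι → Finset X} {κ M L ρ : ℝ}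
    {r : ℕ} (s : ℕ) (hκ : 0 < κ) (hL : 1 ≤ L) (hρ : ρ * κ⁻¹ = L⁻¹)
    (hM : 0 ≤ M) (hr : ∀ i ∈ I, #(f i) ≤ r) (hf : IsSpreadFamily I f κ M)
    {m : Finset X → ℝ} (hm0 : ∀ A, 0 ≤ m A) (hm1 : ∑ A, m A = 1)
    (hm : ∀ A T, Disjoint A T → m A ≤ ρ ^ #T * m (A ∪ T))
    {φ : Finset X → ι → ι} (hφ : ∀ A, ∀ i ∈ I, φ A i ∈ I ∧ f (φ A i) ⊆ A ∪ f i ∧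
      ∀ j ∈ I, f j ⊆ A ∪ f i → #(f (φ A i) \ A) ≤ #(f j \ A)) :
    ∑ A, m A * #{i ∈ I | s < #(f (φ A i) \ A)} ≤ 2 ^ r * (L⁻¹) ^ (s + 1) * M := by
  classical
  obtain ⟨E, hE⟩ := exists_selection_of_subset I f hr
  have hρ0 : 0 ≤ ρ := by
    have : ρ = L⁻¹ * κ := by rw [← hρ]; field_simp
    rw [this]; positivity
  set D : Finset (Σ _ : Finset X, ι) := univ.sigma fun A => {i ∈ I | s < #(f (φ A i) \ A)}
  set R : Finset (Σ _ : Finset X, Σ _ : Finset X, ι) := univ.sigma fun Z =>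
    ({T ∈ (E Z).powerset | s < #T}).sigma fun T => {i ∈ I | T ⊆ f i}
  -- Encode `(A, i)` by `Z = A ∪ T`, the fragment `T` and `i`; since `T` is disjoint from `A`, `A =
  -- Z \ T` is recovered.
  set e : (Σ _ : Finset X, ι) → (Σ _ : Finset X, Σ _ : Finset X, ι) := fun y =>
    ⟨y.1 ∪ (f (φ y.1 y.2) \ y.1), f (φ y.1 y.2) \ y.1, y.2⟩
  have he : Set.InjOn e D := by
    rintro ⟨A, i⟩ - ⟨B, j⟩ - h
    simp only [e, Sigma.mk.injEq, heq_eq_eq] at h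
    obtain ⟨h1, h2, rfl⟩ := h
    have hAB : A = B := by
      rw [h2] at h1
      have h3 : Disjoint A (f (φ B i) \ B) := by rw [← h2]; exact disjoint_sdiff
      calc A = (A ∪ (f (φ B i) \ B)) \ (f (φ B i) \ B) := by
            rw [union_sdiff_right, sdiff_eq_self_of_disjoint h3]
        _ = B := by
            rw [h1, union_sdiff_right, sdiff_eq_self_of_disjoint disjoint_sdiff]
    rw [hAB]
  have hDR : D.image e ⊆ R := by
    intro y hy
    obtain ⟨⟨A, i⟩, hAi, rfl⟩ := mem_image.1 hy
    simp only [D, mem_sigma, mem_univ, true_and, mem_filter] at hAi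
    obtain ⟨hi, hs⟩ := hAi
    obtain ⟨h1, h2, h3⟩ := hφ A i hi
    have hT : f (φ A i) \ A ⊆ f i := by
      intro x hx
      rw [mem_sdiff] at hx
      exact (mem_union.1 (h2 hx.1)).resolve_left hx.2
    obtain ⟨j, hj, hEj, hjZ⟩ := (hE (A ∪ (f (φ A i) \ A))).2 _ h1
      (by rw [union_sdiff_self_eq_union]; exact subset_union_right)
    have hsub : f j \ A ⊆ f (φ A i) \ A := by
      intro x hx
      rw [mem_sdiff] at hx
      exact (mem_union.1 (hjZ hx.1)).resolve_left hx.2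
    -- The selected member of `Z` lies in `A ∪ f i`, so minimality forces its part outside `A` to be
    -- all of `T`; hence `T ⊆ E Z`.
    have heq : f j \ A = f (φ A i) \ A :=
      eq_of_subset_of_card_le hsub (h3 j hj (hjZ.trans (union_subset_union_right hT)))
    simp only [R, e, mem_sigma, mem_univ, true_and, mem_filter, mem_powerset]
    refine ⟨⟨?_, hs⟩, hi, hT⟩
    rw [hEj, ← heq]
    exact sdiff_subset
  calc ∑ A, m A * #{i ∈ I | s < #(f (φ A i) \ A)}
      = ∑ y ∈ D, m y.1 := by
        simp [D, sum_sigma, mul_comm]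
    _ ≤ ∑ y ∈ D, ρ ^ #(e y).2.1 * m (e y).1 := sum_le_sum fun y _ => hm _ _ disjoint_sdiff
    _ = ∑ z ∈ D.image e, ρ ^ #z.2.1 * m z.1 := (sum_image (f := fun z => ρ ^ #z.2.1 * m z.1) he).symm
    _ ≤ ∑ z ∈ R, ρ ^ #z.2.1 * m z.1 :=
        sum_le_sum_of_subset_of_nonneg hDR fun z _ _ => mul_nonneg (pow_nonneg hρ0 _) (hm0 _)
    _ = ∑ Z, m Z * ∑ T ∈ (E Z).powerset with s < #T, ρ ^ #T * #{i ∈ I | T ⊆ f i} := by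
        simp only [R, sum_sigma, sum_const, nsmul_eq_mul, mul_sum]
        refine sum_congr rfl fun Z _ => sum_congr rfl fun T _ => by ring
    _ ≤ ∑ Z, m Z * (2 ^ r * (L⁻¹) ^ (s + 1) * M) := by
        refine sum_le_sum fun Z _ => mul_le_mul_of_nonneg_left ?_ (hm0 Z)
        calc ∑ T ∈ (E Z).powerset with s < #T, ρ ^ #T * (#{i ∈ I | T ⊆ f i} : ℝ)
            ≤ ∑ T ∈ (E Z).powerset with s < #T, (L⁻¹) ^ (s + 1) * M := by
              refine sum_le_sum fun T hT => ?_
              calc ρ ^ #T * (#{i ∈ I | T ⊆ f i} : ℝ) ≤ ρ ^ #T * ((κ⁻¹) ^ #T * M) :=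
                    mul_le_mul_of_nonneg_left (hf T) (pow_nonneg hρ0 _)
                _ = (L⁻¹) ^ #T * M := by rw [← mul_assoc, ← mul_pow, hρ]
                _ ≤ (L⁻¹) ^ (s + 1) * M := by
                    refine mul_le_mul_of_nonneg_right ?_ hM
                    exact pow_le_pow_of_le_one (by positivity) (inv_le_one_of_one_le₀ hL)
                      (mem_filter.1 hT).2
          _ = #{T ∈ (E Z).powerset | s < #T} * ((L⁻¹) ^ (s + 1) * M) := by
              rw [sum_const, nsmul_eq_mul]
          _ ≤ 2 ^ r * ((L⁻¹) ^ (s + 1) * M) := by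
              refine mul_le_mul_of_nonneg_right ?_ (by positivity)
              have h1 : #{T ∈ (E Z).powerset | s < #T} ≤ 2 ^ r :=
                (card_filter_le _ _).trans (by
                  rw [card_powerset]
                  exact Nat.pow_le_pow_right (by norm_num) (hE Z).1)
              exact_mod_cast h1
          _ = 2 ^ r * (L⁻¹) ^ (s + 1) * M := by ring
    _ = 2 ^ r * (L⁻¹) ^ (s + 1) * M := by rw [← sum_mul, hm1, one_mul]

end Fragment

/-! ### The random set of cheap points -/

section LowSet
open Finset
variable {X : Type*} [Fintype X]

open Classical in
/-- The set of points of weight at most `θ`. -/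
noncomputable def lowSet (θ : ℝ) (w : X → ℝ) : Finset X := {x | w x ≤ θ}

theorem mem_lowSet {θ : ℝ} {w : X → ℝ} {x : X} : x ∈ lowSet θ w ↔ w x ≤ θ := by
  simp [lowSet]

theorem preimage_lowSet (θ : ℝ) (A : Finset X) [DecidablePred (· ∈ A)] :
    lowSet θ ⁻¹' {A} = Set.univ.pi fun x => if x ∈ A then Set.Iic θ else Set.Ioi θ := by
  ext w
  simp only [Set.mem_preimage, Set.mem_singleton_iff, Finset.ext_iff, mem_lowSet, Set.mem_pi,
    Set.mem_univ, true_implies]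
  refine forall_congr' fun x => ?_
  split_ifs with h <;> simp [h]

theorem measurableSet_preimage_lowSet (θ : ℝ) (A : Finset X) :
    MeasurableSet (lowSet θ ⁻¹' {A}) := by
  classical
  rw [preimage_lowSet]
  refine MeasurableSet.univ_pi fun x => ?_
  split_ifs
  · exact measurableSet_Iic
  · exact measurableSet_Ioi

theorem expPi_real_preimage_lowSet [DecidableEq X] {θ : ℝ} (hθ : 0 ≤ θ) (A : Finset X) :
    (expPi X).real (lowSet θ ⁻¹' {A}) =
      ∏ x, if x ∈ A then 1 - Real.exp (-θ) else Real.exp (-θ) := by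
  rw [preimage_lowSet, expPi, measureReal_def, Measure.pi_pi, ENNReal.toReal_prod]
  refine prod_congr rfl fun x _ => ?_
  have h := expMeasure_one_real_Ioi θ
  rw [max_eq_left hθ] at h
  split_ifs
  · rw [← measureReal_def, ← Set.compl_Ioi, probReal_compl_eq_one_sub measurableSet_Ioi, h]
  · rw [← measureReal_def, h]

/-- Moving one point into the low set multiplies the probability by `exp θ - 1`, which is at least
`θ`. -/
theorem expPi_real_preimage_lowSet_le [DecidableEq X] {θ : ℝ} (hθ : 0 < θ) {A T : Finset X}
    (hAT : Disjoint A T) :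
    (expPi X).real (lowSet θ ⁻¹' {A}) ≤
      (θ⁻¹) ^ #T * (expPi X).real (lowSet θ ⁻¹' {A ∪ T}) := by
  have he : 0 < Real.exp (-θ) := Real.exp_pos _
  have he1 : Real.exp (-θ) ≤ 1 := Real.exp_le_one_iff.2 (by linarith)
  have hT : (θ⁻¹) ^ #T = ∏ x, if x ∈ T then θ⁻¹ else 1 := by simp
  rw [expPi_real_preimage_lowSet hθ.le, expPi_real_preimage_lowSet hθ.le, hT, ← prod_mul_distrib]
  refine prod_le_prod (fun x _ => by split_ifs <;> linarith) fun x _ => ?_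
  by_cases hxT : x ∈ T
  · have hxA : x ∉ A := fun h => disjoint_left.1 hAT h hxT
    simp only [hxA, hxT, if_false, if_true, mem_union, or_true]
    rw [inv_mul_eq_div, le_div_iff₀ hθ]
    have h1 := mul_le_mul_of_nonneg_left (Real.add_one_le_exp θ) he.le
    rw [← Real.exp_add] at h1
    simp only [neg_add_cancel, Real.exp_zero] at h1
    linarith
  · simp [hxT]

theorem sum_expPi_real_preimage_lowSet (θ : ℝ) :
    ∑ A : Finset X, (expPi X).real (lowSet θ ⁻¹' {A}) = 1 := by
  classical
  rw [← measureReal_biUnion_finset _ fun A _ => measurableSet_preimage_lowSet θ A]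
  · have : ⋃ A ∈ (univ : Finset (Finset X)), lowSet θ ⁻¹' {A} = (Set.univ : Set (X → ℝ)) := by
      ext w; simp
    rw [this, probReal_univ]
  · intro A _ B _ hAB
    exact Disjoint.preimage _ (by simpa using hAB)

end LowSet

/-! ### Cheap members of spread families -/

section HeavySet
open Finset
variable {ι X : Type*}

/-- The weights for which all sets `f i` with `i ∈ I` are heavier than `b`. -/
def heavySet (I : Finset ι) (f : ι → Finset X) (b : ℝ) : Set (X → ℝ) :=
  {w | ∀ i ∈ I, b < ∑ x ∈ f i, w x}

theorem measurableSet_heavySet (I : Finset ι) (f : ι → Finset X) (b : ℝ) :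
    MeasurableSet (heavySet I f b) := by
  have : heavySet I f b = ⋂ i ∈ I, {w | b < ∑ x ∈ f i, w x} := by
    ext w; simp [heavySet]
  rw [this]
  exact Finset.measurableSet_biInter _ fun i _ =>
    measurableSet_lt measurable_const (Finset.measurable_fun_sum _ fun x _ => measurable_pi_apply x)

theorem heavySet_anti (I : Finset ι) (f : ι → Finset X) {b b' : ℝ} (h : b ≤ b') :
    heavySet I f b' ⊆ heavySet I f b := fun _ hw i hi => h.trans_lt (hw i hi)

theorem IsSpreadFamily.card_le [DecidableEq X] {I : Finset ι} {f : ι → Finset X} {κ M : ℝ}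
    (hf : IsSpreadFamily I f κ M) : (#I : ℝ) ≤ M := by
  simpa using hf ∅

variable [Fintype X]

/-- Points in the low set are charged to the first copy, at most `θ / q` each; the remaining
fragment is charged to the second. -/
theorem mem_heavySet_of_minSplit_mem [DecidableEq X] {I J : Finset ι} {f : ι → Finset X} {φ : ι → ι}
    {r : ℕ} {q θ b : ℝ} {y : (X → ℝ) × (X → ℝ)} (hq0 : 0 < q) (hq1 : q < 1) (hθ : 0 ≤ θ)
    (hr : ∀ i ∈ I, #(f i) ≤ r) (hφ : ∀ i ∈ J, φ i ∈ I)
    (hy : minSplit q y ∈ heavySet I f (r * (θ / q) + b / (1 - q))) :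
    y.2 ∈ heavySet J (fun i => f (φ i) \ lowSet θ y.1) b := by
  intro i hi
  have hq' : 0 < 1 - q := by linarith
  have h := hy (φ i) (hφ i hi)
  by_contra! hle
  refine absurd h (not_lt.2 ?_)
  rw [← sum_inter_add_sum_sdiff (f (φ i)) (lowSet θ y.1)]
  refine add_le_add ?_ ?_
  · calc ∑ x ∈ f (φ i) ∩ lowSet θ y.1, minSplit q y x
        ≤ ∑ x ∈ f (φ i) ∩ lowSet θ y.1, θ / q := by
          refine sum_le_sum fun x hx => (min_le_left _ _).trans ?_
          exact div_le_div_of_nonneg_right (mem_lowSet.1 (mem_inter.1 hx).2) hq0.le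
      _ = #(f (φ i) ∩ lowSet θ y.1) * (θ / q) := by rw [sum_const, nsmul_eq_mul]
      _ ≤ r * (θ / q) := by
          refine mul_le_mul_of_nonneg_right ?_ (by positivity)
          exact_mod_cast (card_le_card inter_subset_left).trans (hr _ (hφ i hi))
  · calc ∑ x ∈ f (φ i) \ lowSet θ y.1, minSplit q y x
        ≤ ∑ x ∈ f (φ i) \ lowSet θ y.1, y.2 x / (1 - q) :=
          sum_le_sum fun x _ => min_le_right _ _
      _ = (∑ x ∈ f (φ i) \ lowSet θ y.1, y.2 x) / (1 - q) := by rw [sum_div]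
      _ ≤ b / (1 - q) := div_le_div_of_nonneg_right hle hq'.le

theorem two_pow_mul_inv_pow_le (r : ℕ) :
    (2 : ℝ) ^ r * ((36 : ℝ)⁻¹) ^ (r / 2 + 1) ≤ (1 / 3) ^ r := by
  have h : ((36 : ℝ)⁻¹) ^ (r / 2 + 1) ≤ (1 / 6) ^ r := by
    have h36 : ((36 : ℝ)⁻¹) = (1 / 6) ^ 2 := by norm_num
    rw [h36, ← pow_mul]
    exact pow_le_pow_of_le_one (by norm_num) (by norm_num) (by omega)
  calc (2 : ℝ) ^ r * ((36 : ℝ)⁻¹) ^ (r / 2 + 1) ≤ 2 ^ r * (1 / 6) ^ r := by gcongr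
    _ = (1 / 3) ^ r := by rw [← mul_pow]; norm_num

/-- In a spread family of sets of size at most `r`, some set probably has weight at most a constant
times `r / κ`. -/
theorem expPi_real_heavySet_le [DecidableEq X] {κ M : ℝ} (hκ : 0 < κ) (hM : 0 < M) (r : ℕ) (I : Finset ι)
    (f : ι → Finset X) (hr : ∀ i ∈ I, #(f i) ≤ r) (hf : IsSpreadFamily I f κ M) :
    (expPi X).real (heavySet I f (432 * r / κ)) ≤ 1 - #I / M + (1 - (1 / 3) ^ r) / 2 := by
  induction r using Nat.strong_induction_on generalizing I f with
  | _ r ih =>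
  rcases Nat.eq_zero_or_pos r with rfl | hr0
  · rcases I.eq_empty_or_nonempty with rfl | ⟨i, hi⟩
    · simp
    · have hfi : f i = ∅ := by simpa using hr i hi
      have : heavySet I f (432 * (0 : ℕ) / κ) = ∅ := by
        ext w
        simp only [heavySet, Set.mem_ofPred_eq, Set.mem_empty_iff_false, iff_false]
        intro h
        simpa [hfi] using h i hi
      rw [this, measureReal_empty]
      have := (div_le_one hM).2 hf.card_le
      simp only [pow_zero, sub_self, zero_div, add_zero]
      linarith
  set s := r / 2 with hs
  -- The factor 36 = 6² gives 6^(-r) for fragments larger than `r / 2`, which beats the `2 ^ r`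
  -- choices of fragment.
  set θ := 36 / κ with hθ
  have hθ0 : 0 < θ := by positivity
  obtain ⟨φ, hφ⟩ := exists_minimal_fragment I f
  set m : Finset X → ℝ := fun A => (expPi X).real (lowSet θ ⁻¹' {A})
  have hm0 : ∀ A, 0 ≤ m A := fun A => measureReal_nonneg
  have hm1 : ∑ A, m A = 1 := sum_expPi_real_preimage_lowSet θ
  set g : Finset X → ι → Finset X := fun A i => f (φ A i) \ A
  set bad : Finset X → Finset ι := fun A => {i ∈ I | s < #(g A i)}
  set J : Finset X → Finset ι := fun A => {i ∈ I | #(g A i) ≤ s} with hJ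
  have hcard : ∀ A, (#(J A) : ℝ) = #I - #(bad A) := by
    intro A
    have := card_filter_add_card_filter_not (s := I) (fun i => #(g A i) ≤ s)
    simp only [not_le] at this
    rw [eq_sub_iff_add_eq]
    exact_mod_cast this
  have hbad : ∑ A, m A * #(bad A) ≤ (1 / 3) ^ r * M := by
    refine (sum_card_large_fragment_le (L := 36) (ρ := θ⁻¹) s hκ (by norm_num)
      (by rw [hθ]; field_simp) hM.le hr hf hm0 hm1
      (fun A T h => expPi_real_preimage_lowSet_le hθ0 h) hφ).trans ?_
    exact mul_le_mul_of_nonneg_right (two_pow_mul_inv_pow_le r) hM.le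
  -- Fragments keep their original indices, with multiplicity, and `g A i ⊆ f i`; so `κ` and `M` are
  -- unchanged and the loss shows only in `#(J A)`.
  have hspread : ∀ A, IsSpreadFamily (J A) (g A) κ M := by
    intro A U
    refine le_trans ?_ (hf U)
    have hsub : {i ∈ J A | U ⊆ g A i} ⊆ {i ∈ I | U ⊆ f i} := by
      intro i hi
      simp only [hJ, mem_filter] at hi ⊢
      refine ⟨hi.1.1, hi.2.trans fun x hx => ?_⟩
      rw [mem_sdiff] at hx
      exact (mem_union.1 ((hφ A i hi.1.1).2.1 hx.1)).resolve_left hx.2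
    exact_mod_cast card_le_card hsub
  have hstep : ∀ A, (expPi X).real (heavySet (J A) (g A) (432 * s / κ)) ≤
      1 - #(J A) / M + (1 - (1 / 3) ^ s) / 2 := fun A =>
    ih s (by omega) (J A) (g A) (fun i hi => (mem_filter.1 hi).2) (hspread A)
  have hsub : minSplit (1 / 4) ⁻¹' heavySet I f (432 * r / κ) ⊆
      ⋃ A ∈ (univ : Finset (Finset X)),
        (lowSet θ ⁻¹' {A}) ×ˢ heavySet (J A) (g A) (432 * s / κ) := by
    intro y hy
    simp only [mem_univ, Set.iUnion_true, Set.mem_iUnion]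
    refine ⟨lowSet θ y.1, rfl, ?_⟩
    refine mem_heavySet_of_minSplit_mem (q := 1 / 4) (by norm_num) (by norm_num) hθ0.le hr
      (fun i hi => (hφ _ i (mem_filter.1 hi).1).1) (heavySet_anti I f ?_ hy)
    -- The constant 432 solves c = 4 · 36 + (4/3)(c/2), the cost recursion for `q = 1 / 4`.
    have h2 : (s : ℝ) ≤ r / 2 := Nat.cast_div_le
    rw [hθ]
    have : r * (36 / κ / (1 / 4)) + 432 * s / κ / (1 - 1 / 4) = (144 * r + 576 * s) / κ := by
      ring
    rw [this]
    exact div_le_div_of_nonneg_right (by linarith) hκ.le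
  -- This lets the error term `(1 - (1 / 3) ^ r) / 2` absorb the new loss `(1 / 3) ^ r`; it uses `s
  -- < r`.
  have hpow : (1 / 3 : ℝ) ^ r ≤ (1 / 3) ^ s * (1 / 3) := by
    rw [← pow_succ]
    exact pow_le_pow_of_le_one (by norm_num) (by norm_num) (by omega)
  calc (expPi X).real (heavySet I f (432 * r / κ))
      = ((expPi X).prod (expPi X)).real (minSplit (1 / 4) ⁻¹' heavySet I f (432 * r / κ)) :=
        ((measurePreserving_minSplit X (by norm_num) (by norm_num)).measureReal_preimage
          (measurableSet_heavySet _ _ _).nullMeasurableSet).symm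
    _ ≤ ∑ A, ((expPi X).prod (expPi X)).real
          ((lowSet θ ⁻¹' {A}) ×ˢ heavySet (J A) (g A) (432 * s / κ)) :=
        (measureReal_mono hsub (measure_ne_top _ _)).trans (measureReal_biUnion_finset_le _ _)
    _ = ∑ A, m A * (expPi X).real (heavySet (J A) (g A) (432 * s / κ)) := by
        simp only [measureReal_prod_prod, m]
    _ ≤ ∑ A, m A * (1 - #(J A) / M + (1 - (1 / 3) ^ s) / 2) :=
        sum_le_sum fun A _ => mul_le_mul_of_nonneg_left (hstep A) (hm0 A)
    _ = ∑ A, (m A * (1 - #I / M + (1 - (1 / 3) ^ s) / 2) + m A * #(bad A) / M) := by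
        refine sum_congr rfl fun A _ => ?_
        rw [hcard]
        ring
    _ = 1 - #I / M + (1 - (1 / 3) ^ s) / 2 + (∑ A, m A * #(bad A)) / M := by
        rw [sum_add_distrib, ← sum_mul, hm1, one_mul, sum_div]
    _ ≤ 1 - #I / M + (1 - (1 / 3) ^ s) / 2 + (1 / 3) ^ r := by
        gcongr
        exact (div_le_iff₀ hM).2 hbad
    _ ≤ 1 - #I / M + (1 - (1 / 3) ^ r) / 2 := by linarith

/-- Splitting with `q = 1 / (k + 1)` scales the copies by `k + 1` and `(k + 1) / k`, so both must be
heavy, at `u` and at `k * u`, independently. -/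
theorem expPi_real_heavySet_succ_mul_le (I : Finset ι) (f : ι → Finset X) (u : ℝ) {k : ℕ}
    (hk : 1 ≤ k) :
    (expPi X).real (heavySet I f ((k + 1 : ℕ) * u)) ≤
      (expPi X).real (heavySet I f u) * (expPi X).real (heavySet I f (k * u)) := by
  have hk0 : (0 : ℝ) < k := by exact_mod_cast hk
  set q : ℝ := 1 / (k + 1) with hq
  have hq0 : 0 < q := by positivity
  have hq1 : q < 1 := (div_lt_one (by positivity)).2 (by linarith)
  have hq' : 1 - q = k / (k + 1) := by rw [hq]; field_simp; ring
  have hsub : minSplit q ⁻¹' heavySet I f ((k + 1 : ℕ) * u) ⊆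
      heavySet I f u ×ˢ heavySet I f (k * u) := by
    intro y hy
    push_cast at hy
    refine ⟨fun i hi => ?_, fun i hi => ?_⟩
    · have h : (k + 1) * u < (∑ x ∈ f i, y.1 x) / q :=
        (hy i hi).trans_le (by rw [sum_div]; exact sum_le_sum fun x _ => min_le_left _ _)
      rw [lt_div_iff₀ hq0, hq] at h
      field_simp at h
      exact h
    · have h : (k + 1) * u < (∑ x ∈ f i, y.2 x) / (1 - q) :=
        (hy i hi).trans_le (by rw [sum_div]; exact sum_le_sum fun x _ => min_le_right _ _)
      rw [lt_div_iff₀ (by linarith), hq'] at h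
      field_simp at h
      linarith
  rw [← (measurePreserving_minSplit X hq0 hq1).measureReal_preimage
    (measurableSet_heavySet _ _ _).nullMeasurableSet, ← measureReal_prod_prod]
  exact measureReal_mono hsub

theorem expPi_heavySet_mul_le {I : Finset ι} {f : ι → Finset X} {u : ℝ}
    (h : (expPi X).real (heavySet I f u) ≤ 1 / 2) (k : ℕ) :
    expPi X (heavySet I f (k * u)) ≤ 2⁻¹ ^ k := by
  have hreal : (expPi X).real (heavySet I f (k * u)) ≤ (1 / 2) ^ k := by
    rcases Nat.eq_zero_or_pos k with rfl | hk
    · simp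
    induction k, hk using Nat.le_induction with
    | base => simpa using h
    | succ k hk ih =>
      calc _ ≤ _ := expPi_real_heavySet_succ_mul_le I f u hk
        _ ≤ 1 / 2 * (1 / 2) ^ k := mul_le_mul h ih measureReal_nonneg (by norm_num)
        _ = (1 / 2) ^ (k + 1) := by ring
  rw [← ENNReal.ofReal_toReal (measure_ne_top (expPi X) _)]
  refine (ENNReal.ofReal_le_ofReal hreal).trans_eq ?_
  rw [ENNReal.ofReal_pow (by norm_num), one_div, ENNReal.ofReal_inv_of_pos (by norm_num)]
  simp

end HeavySet

/-! ### From tails to the mean -/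

/-- A function with geometric tails at the multiples of `u` has integral at most `2 * u`. -/
theorem lintegral_ofReal_le_of_geometric_tail {α : Type*} [MeasurableSpace α] {μ : Measure α}
    {g : α → ℝ} {u : ℝ} (hu : 0 < u) (hg : Measurable g)
    (h : ∀ k : ℕ, μ {a | k * u < g a} ≤ 2⁻¹ ^ k) :
    ∫⁻ a, ENNReal.ofReal (g a) ∂μ ≤ ENNReal.ofReal (2 * u) := by
  have hmeas : ∀ k : ℕ, MeasurableSet {a | k * u < g a} := fun k =>
    measurableSet_lt measurable_const hg
  have hpt : ∀ a, ENNReal.ofReal (g a) ≤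
      ∑' k : ℕ, {a | k * u < g a}.indicator (fun _ => ENNReal.ofReal u) a := by
    intro a
    refine le_trans ?_ (ENNReal.sum_le_tsum (Finset.range ⌈g a / u⌉₊))
    calc ENNReal.ofReal (g a) ≤ ENNReal.ofReal (⌈g a / u⌉₊ * u) :=
          ENNReal.ofReal_le_ofReal ((div_le_iff₀ hu).1 (Nat.le_ceil _))
      _ = ∑ k ∈ Finset.range ⌈g a / u⌉₊, ENNReal.ofReal u := by
          rw [Finset.sum_const, Finset.card_range, nsmul_eq_mul,
            ENNReal.ofReal_mul (Nat.cast_nonneg _), ENNReal.ofReal_natCast]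
      _ ≤ _ := by
          refine Finset.sum_le_sum fun k hk => ?_
          rw [Set.indicator_of_mem]
          exact (lt_div_iff₀ hu).1 (Nat.lt_ceil.1 (Finset.mem_range.1 hk))
  calc ∫⁻ a, ENNReal.ofReal (g a) ∂μ
      ≤ ∫⁻ a, ∑' k : ℕ, {a | k * u < g a}.indicator (fun _ => ENNReal.ofReal u) a ∂μ :=
        lintegral_mono hpt
    _ = ∑' k : ℕ, ENNReal.ofReal u * μ {a | k * u < g a} := by
        rw [lintegral_tsum fun k => (measurable_const.indicator (hmeas k)).aemeasurable]
        simp only [lintegral_indicator_const (hmeas _)]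
    _ ≤ ∑' k : ℕ, ENNReal.ofReal u * 2⁻¹ ^ k :=
        ENNReal.tsum_le_tsum fun k => mul_le_mul_right (h k) _
    _ = ENNReal.ofReal (2 * u) := by
        rw [ENNReal.tsum_mul_left, ENNReal.tsum_geometric, ENNReal.one_sub_inv_two, inv_inv,
          mul_comm, ENNReal.ofReal_mul (by norm_num)]
        simp

/-! ### Counting permutations -/

section Permutations
open Finset

/-- Composing with `σ⁻¹` reduces to permutations fixing `A` pointwise, which are permutations of the
complement. -/
theorem card_perm_eqOn_le {α : Type*} [Fintype α] [DecidableEq α] (σ : Equiv.Perm α)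
    (A : Finset α) :
    #{τ : Equiv.Perm α | ∀ a ∈ A, τ a = σ a} ≤ (Fintype.card α - #A).factorial := by
  have h1 : #{τ : Equiv.Perm α | ∀ a ∈ A, τ a = σ a} ≤
      #{τ : Equiv.Perm α | ∀ a, ¬ a ∉ A → τ a = a} := by
    refine card_le_card_of_injOn (fun τ => σ⁻¹ * τ) ?_ (mul_right_injective _).injOn
    intro τ hτ
    simp only [coe_filter, mem_univ, true_and, Set.mem_ofPred_eq, not_not, Equiv.Perm.mul_apply]
      at hτ ⊢
    intro a ha
    rw [hτ a ha, Equiv.Perm.inv_def, Equiv.symm_apply_apply]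
  refine h1.trans_eq ?_
  rw [← Fintype.card_subtype, ← Fintype.card_congr (Equiv.Perm.subtypeEquivSubtypePerm (· ∉ A)),
    Fintype.card_perm, Fintype.card_subtype_compl]
  simp

theorem add_one_pow_le_exp_mul_pow {n u : ℕ} (h : u ≤ n) :
    ((n : ℝ) + 1) ^ u ≤ Real.exp 1 * n ^ u := by
  rcases Nat.eq_zero_or_pos n with rfl | hn
  · obtain rfl : u = 0 := by omega
    simp
  have hn0 : (0 : ℝ) < n := by exact_mod_cast hn
  have h1 : ((n : ℝ) + 1) = n * (1 / n + 1) := by field_simp; ring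
  rw [h1, mul_pow, mul_comm]
  refine mul_le_mul_of_nonneg_right ?_ (by positivity)
  calc (1 / (n : ℝ) + 1) ^ u ≤ Real.exp (1 / n) ^ u :=
        pow_le_pow_left₀ (by positivity) (Real.add_one_le_exp _) _
    _ = Real.exp (u * (1 / n)) := (Real.exp_nat_mul _ _).symm
    _ ≤ Real.exp 1 := by
        refine Real.exp_le_exp.2 ?_
        rw [mul_one_div, div_le_one hn0]
        exact_mod_cast h

theorem factorial_sub_mul_pow_le {n u : ℕ} (h : u ≤ n) :
    ((n - u).factorial : ℝ) * n ^ u ≤ n.factorial * Real.exp 1 ^ u := by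
  induction u generalizing n with
  | zero => simp
  | succ u ih =>
    obtain ⟨n, rfl⟩ : ∃ m, n = m + 1 := ⟨n - 1, by omega⟩
    have hu : u ≤ n := by omega
    rw [Nat.add_sub_add_right, Nat.factorial_succ]
    push_cast
    calc ((n - u).factorial : ℝ) * (n + 1) ^ (u + 1)
        = (n - u).factorial * (n + 1) ^ u * (n + 1) := by ring
      _ ≤ (n - u).factorial * (Real.exp 1 * n ^ u) * (n + 1) := by
          gcongr
          exact add_one_pow_le_exp_mul_pow hu
      _ = Real.exp 1 * ((n - u).factorial * n ^ u) * (n + 1) := by ring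
      _ ≤ Real.exp 1 * (n.factorial * Real.exp 1 ^ u) * (n + 1) :=
          mul_le_mul_of_nonneg_right
            (mul_le_mul_of_nonneg_left (ih hu) (Real.exp_pos 1).le) (by positivity)
      _ = (n + 1) * n.factorial * Real.exp 1 ^ (u + 1) := by ring

end Permutations

/-! ### Graphs of permutations as a spread family -/

section AxialGraph
open Finset

/-- The set of points `(a, σ₁ a, …, σₖ a)`. -/
def axialGraph {k n : ℕ} (σ : Fin k → Equiv.Perm (Fin n)) : Finset (Fin (k + 1) → Fin n) :=
  {x | ∀ i, x i.succ = σ i (x 0)}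

theorem mem_axialGraph {k n : ℕ} {σ : Fin k → Equiv.Perm (Fin n)} {x : Fin (k + 1) → Fin n} :
    x ∈ axialGraph σ ↔ ∀ i, x i.succ = σ i (x 0) := by
  simp [axialGraph]

theorem eq_of_mem_axialGraph {k n : ℕ} {σ : Fin k → Equiv.Perm (Fin n)}
    {x y : Fin (k + 1) → Fin n} (hx : x ∈ axialGraph σ) (hy : y ∈ axialGraph σ)
    (h : x 0 = y 0) : x = y := by
  rw [mem_axialGraph] at hx hy
  funext i
  refine Fin.cases h (fun j => ?_) i
  rw [hx, hy, h]

theorem isAxialAssignment_axialGraph {k n : ℕ} (σ : Fin k → Equiv.Perm (Fin n)) :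
    IsAxialAssignment (axialGraph σ) := by
  have hmem : ∀ b, (Fin.cons b fun i => σ i b : Fin (k + 1) → Fin n) ∈ axialGraph σ := fun b => by
    simp [mem_axialGraph]
  intro i a
  refine Fin.cases ?_ (fun j => ?_) i
  · exact ⟨_, ⟨hmem a, rfl⟩, fun y hy => eq_of_mem_axialGraph hy.1 (hmem a) (by simp [hy.2])⟩
  · refine ⟨_, ⟨hmem ((σ j).symm a), by simp⟩, fun y hy =>
      eq_of_mem_axialGraph hy.1 (hmem _) ?_⟩
    have h := mem_axialGraph.1 hy.1 j
    rw [hy.2] at h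
    simp [h]

theorem card_axialGraph_le {k n : ℕ} (σ : Fin k → Equiv.Perm (Fin n)) : #(axialGraph σ) ≤ n := by
  calc #(axialGraph σ) ≤ #(univ : Finset (Fin n)) :=
        card_le_card_of_injOn (fun x => x 0) (fun _ _ => by simp)
          fun x hx y hy h => eq_of_mem_axialGraph hx hy h
    _ = n := by simp

/-- A graph containing `U` has each of its `k` permutations prescribed at `#U` distinct arguments,
leaving at most `(n - #U)!` choices for each. -/
theorem isSpreadFamily_axialGraph (k n : ℕ) (hn : 1 ≤ n) :
    IsSpreadFamily (univ : Finset (Fin k → Equiv.Perm (Fin n))) axialGraph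
      ((n / Real.exp 1) ^ k) ((n.factorial : ℝ) ^ k) := by
  intro U
  have hn0 : (0 : ℝ) < n := by exact_mod_cast hn
  rcases (filter (fun σ : Fin k → Equiv.Perm (Fin n) => U ⊆ axialGraph σ) univ).eq_empty_or_nonempty
    with h | ⟨σ₀, h⟩
  · rw [h, card_empty, Nat.cast_zero]
    positivity
  have hU : U ⊆ axialGraph σ₀ := (mem_filter.1 h).2
  have hA : #(U.image fun x => x 0) = #U :=
    card_image_of_injOn fun x hx y hy hxy => eq_of_mem_axialGraph (hU hx) (hU hy) hxy
  have hle : #U ≤ n := (card_le_card hU).trans (card_axialGraph_le σ₀)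
  have hcard : #{σ : Fin k → Equiv.Perm (Fin n) | U ⊆ axialGraph σ} ≤
      (n - #U).factorial ^ k := by
    calc #{σ : Fin k → Equiv.Perm (Fin n) | U ⊆ axialGraph σ}
        ≤ #(Fintype.piFinset fun i =>
            {τ : Equiv.Perm (Fin n) | ∀ a ∈ U.image (fun x => x 0), τ a = σ₀ i a}) := by
          refine card_le_card fun σ hσ => ?_
          simp only [mem_filter, mem_univ, true_and, Fintype.mem_piFinset, mem_image,
            forall_exists_index, and_imp, forall_apply_eq_imp_iff₂] at hσ ⊢
          intro i x hx
          rw [← mem_axialGraph.1 (hσ hx) i, ← mem_axialGraph.1 (hU hx) i]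
      _ ≤ ∏ _i : Fin k, (n - #U).factorial := by
          rw [Fintype.card_piFinset]
          refine prod_le_prod' fun i _ => ?_
          simpa [hA] using card_perm_eqOn_le (σ₀ i) (U.image fun x => x 0)
      _ = (n - #U).factorial ^ k := by simp
  have hfac : ((n - #U).factorial : ℝ) ≤ ((n / Real.exp 1)⁻¹) ^ #U * n.factorial := by
    rw [inv_div, div_pow, div_mul_eq_mul_div, le_div_iff₀ (by positivity),
      mul_comm (Real.exp 1 ^ _)]
    exact factorial_sub_mul_pow_le hle
  calc (#{σ : Fin k → Equiv.Perm (Fin n) | U ⊆ axialGraph σ} : ℝ)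
      ≤ ((n - #U).factorial : ℝ) ^ k := by exact_mod_cast hcard
    _ ≤ (((n / Real.exp 1)⁻¹) ^ #U * n.factorial) ^ k :=
        pow_le_pow_left₀ (by positivity) hfac _
    _ = _ := by rw [mul_pow, ← inv_pow, ← pow_mul, ← pow_mul, mul_comm (#U)]

end AxialGraph

/-! ### Upper bound for the mean -/

section MinAxialWeight
open Finset
variable {k n : ℕ}

theorem measurable_minAxialWeight {d n : ℕ} :
    Measurable (minAxialWeight : ((Fin d → Fin n) → ℝ) → ℝ) := by
  unfold minAxialWeight
  refine Continuous.measurable (Continuous.finset_inf'_apply _ fun S _ => ?_)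
  fun_prop

theorem minAxialWeight_nonneg {d n : ℕ} {w : (Fin d → Fin n) → ℝ} (hw : ∀ x, 0 ≤ w x) :
    0 ≤ minAxialWeight w :=
  Finset.le_inf' _ _ fun _ _ => sum_nonneg fun x _ => hw x

theorem minAxialWeight_le {d n : ℕ} {w : (Fin d → Fin n) → ℝ} {S : Finset (Fin d → Fin n)}
    (hS : IsAxialAssignment S) : minAxialWeight w ≤ ∑ x ∈ S, w x :=
  Finset.inf'_le (fun S => ∑ x ∈ S, w x) (by simp [axialAssignments, hS])

theorem expPi_lt_minAxialWeight_le (hn : 1 ≤ n) (j : ℕ) :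
    expPi (Fin (k + 1) → Fin n) {w | j * (432 * n / (n / Real.exp 1) ^ k) < minAxialWeight w} ≤
      2⁻¹ ^ j := by
  have hn0 : (0 : ℝ) < n := by exact_mod_cast hn
  have hM : (0 : ℝ) < (n.factorial : ℝ) ^ k := by positivity
  have h := expPi_real_heavySet_le (κ := (n / Real.exp 1) ^ k) (by positivity) hM n
    (univ : Finset (Fin k → Equiv.Perm (Fin n))) axialGraph (fun σ _ => card_axialGraph_le σ)
    (isSpreadFamily_axialGraph k n hn)
  have hcard : (#(univ : Finset (Fin k → Equiv.Perm (Fin n))) : ℝ) = (n.factorial : ℝ) ^ k := by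
    simp [Fintype.card_perm]
  -- Here `M` is the size of the whole family, so `1 - #I / M` vanishes and a probability of at most
  -- 1/2 remains.
  rw [hcard, div_self hM.ne'] at h
  have h3 : (0 : ℝ) ≤ (1 / 3) ^ n := by positivity
  refine (measure_mono ?_).trans (expPi_heavySet_mul_le (h.trans (by linarith)) j)
  exact fun w hw σ _ => lt_of_lt_of_le hw (minAxialWeight_le (isAxialAssignment_axialGraph σ))

theorem lintegral_minAxialWeight_le (hn : 1 ≤ n) :
    ∫⁻ w, ENNReal.ofReal (minAxialWeight w) ∂expPi (Fin (k + 1) → Fin n) ≤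
      ENNReal.ofReal (2 * (432 * n / (n / Real.exp 1) ^ k)) := by
  have hn0 : (0 : ℝ) < n := by exact_mod_cast hn
  exact lintegral_ofReal_le_of_geometric_tail (by positivity) measurable_minAxialWeight
    (expPi_lt_minAxialWeight_le hn)

theorem ae_expPi_minAxialWeight_nonneg :
    0 ≤ᵐ[expPi (Fin (k + 1) → Fin n)] minAxialWeight :=
  (ae_expPi_nonneg _).mono fun _ hw => minAxialWeight_nonneg hw

theorem integrable_minAxialWeight (hn : 1 ≤ n) :
    Integrable minAxialWeight (expPi (Fin (k + 1) → Fin n)) := by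
  refine ⟨measurable_minAxialWeight.aestronglyMeasurable, ?_⟩
  rw [hasFiniteIntegral_iff_ofReal ae_expPi_minAxialWeight_nonneg]
  exact (lintegral_minAxialWeight_le hn).trans_lt ENNReal.ofReal_lt_top

theorem integral_minAxialWeight_le (hn : 1 ≤ n) :
    ∫ w, minAxialWeight w ∂expPi (Fin (k + 1) → Fin n) ≤
      2 * (432 * n / (n / Real.exp 1) ^ k) := by
  rw [integral_eq_lintegral_of_nonneg_ae ae_expPi_minAxialWeight_nonneg
    measurable_minAxialWeight.aestronglyMeasurable]
  exact ENNReal.toReal_le_of_le_ofReal (by positivity) (lintegral_minAxialWeight_le hn)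

/-! ### Lower bound for the mean -/

/-- The weights which exceed `t` on the hyperplane `x 0 = a`. -/
def heavyHyperplane (k : ℕ) {n : ℕ} (t : ℝ) (a : Fin n) : Set ((Fin (k + 1) → Fin n) → ℝ) :=
  Set.univ.pi fun x => if x 0 = a then Set.Ioi t else Set.univ

theorem measurableSet_heavyHyperplane (t : ℝ) (a : Fin n) :
    MeasurableSet (heavyHyperplane k t a) := by
  refine MeasurableSet.univ_pi fun x => ?_
  split_ifs
  · exact measurableSet_Ioi
  · exact MeasurableSet.univ

theorem card_hyperplane_le (k : ℕ) (a : Fin n) :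
    #{x : Fin (k + 1) → Fin n | x 0 = a} ≤ n ^ k := by
  calc #{x : Fin (k + 1) → Fin n | x 0 = a} ≤ #(univ : Finset (Fin k → Fin n)) := by
        refine card_le_card_of_injOn Fin.tail (fun _ _ => by simp) fun x hx y hy h => ?_
        simp only [coe_filter, mem_univ, true_and, Set.mem_ofPred_eq] at hx hy
        rw [← Fin.cons_self_tail x, ← Fin.cons_self_tail y, h, hx, hy]
    _ = n ^ k := by simp

theorem exp_neg_one_le_expPi_real_heavyHyperplane (hn : 1 ≤ n) (a : Fin n) :
    Real.exp (-1) ≤ (expPi (Fin (k + 1) → Fin n)).real (heavyHyperplane k ((n : ℝ) ^ k)⁻¹ a) := by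
  have hn0 : (0 : ℝ) < n := by exact_mod_cast hn
  have ht : (0 : ℝ) ≤ ((n : ℝ) ^ k)⁻¹ := by positivity
  have h : ∀ x : Fin (k + 1) → Fin n, (expMeasure 1 (if x 0 = a then Set.Ioi ((n : ℝ) ^ k)⁻¹
      else Set.univ)).toReal = if x 0 = a then Real.exp (-((n : ℝ) ^ k)⁻¹) else 1 := by
    intro x
    split_ifs
    · rw [← measureReal_def, expMeasure_one_real_Ioi, max_eq_left ht]
    · simp
  rw [heavyHyperplane, expPi, measureReal_def, Measure.pi_pi, ENNReal.toReal_prod]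
  simp only [h]
  rw [prod_ite, prod_const, prod_const_one, mul_one, ← Real.exp_nat_mul]
  refine Real.exp_le_exp.2 ?_
  rw [mul_neg, neg_le_neg_iff, ← div_eq_mul_inv, div_le_one (by positivity)]
  exact_mod_cast card_hyperplane_le k a

/-- The fibres of `x ↦ x 0` partition an assignment, and its point in a heavy hyperplane costs more
than `t`. -/
theorem sum_indicator_heavyHyperplane_le {t : ℝ} {w : (Fin (k + 1) → Fin n) → ℝ}
    (hw : ∀ x, 0 ≤ w x) :
    ∑ a, (heavyHyperplane k t a).indicator (fun _ => t) w ≤ minAxialWeight w := by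
  classical
  refine Finset.le_inf' _ _ fun S hS => ?_
  have hS' : IsAxialAssignment S := by simpa [axialAssignments] using hS
  rw [← sum_fiberwise S (fun x => x 0) w]
  refine sum_le_sum fun a _ => ?_
  obtain ⟨x, ⟨hxS, hxa⟩, -⟩ := hS' 0 a
  have hx : w x ≤ ∑ y ∈ S with y 0 = a, w y :=
    single_le_sum (fun y _ => hw y) (mem_filter.2 ⟨hxS, hxa⟩)
  refine le_trans ?_ hx
  by_cases h : w ∈ heavyHyperplane k t a
  · rw [Set.indicator_of_mem h]
    have := h x (Set.mem_univ x)
    simp only [if_pos hxa, Set.mem_Ioi] at this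
    exact this.le
  · rw [Set.indicator_of_notMem h]
    exact hw x

theorem le_integral_minAxialWeight (hn : 1 ≤ n) :
    n * (((n : ℝ) ^ k)⁻¹ * Real.exp (-1)) ≤
      ∫ w, minAxialWeight w ∂expPi (Fin (k + 1) → Fin n) := by
  set t : ℝ := ((n : ℝ) ^ k)⁻¹ with ht
  have ht0 : 0 ≤ t := by positivity
  have hint : ∀ a : Fin n, Integrable ((heavyHyperplane k t a).indicator fun _ => t)
      (expPi (Fin (k + 1) → Fin n)) := fun a =>
    (integrable_const t).indicator (measurableSet_heavyHyperplane t a)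
  calc n * (t * Real.exp (-1)) = ∑ _a : Fin n, Real.exp (-1) * t := by simp [mul_comm]
    _ ≤ ∑ a : Fin n, (expPi (Fin (k + 1) → Fin n)).real (heavyHyperplane k t a) * t :=
        sum_le_sum fun a _ => mul_le_mul_of_nonneg_right
          (exp_neg_one_le_expPi_real_heavyHyperplane hn a) ht0
    _ = ∫ w, ∑ a, (heavyHyperplane k t a).indicator (fun _ => t) w
          ∂expPi (Fin (k + 1) → Fin n) := by
        rw [integral_finsetSum _ fun a _ => hint a]
        refine sum_congr rfl fun a _ => ?_
        rw [integral_indicator_const _ (measurableSet_heavyHyperplane t a), smul_eq_mul]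
    _ ≤ _ := integral_mono_ae (integrable_finsetSum _ fun a _ => hint a)
        (integrable_minAxialWeight hn)
        ((ae_expPi_nonneg _).mono fun w hw => sum_indicator_heavyHyperplane_le hw)

end MinAxialWeight

/-! ### Transfer to arbitrary probability spaces -/

theorem map_eq_expPi {X Ω : Type*} [Fintype X] [MeasurableSpace Ω] {P : Measure Ω}
    [IsProbabilityMeasure P] {ξ : X → Ω → ℝ} (hlaw : ∀ x, HasLaw (ξ x) (expMeasure 1) P)
    (hind : iIndepFun ξ P) : P.map (fun ω x => ξ x ω) = expPi X := by
  rw [(iIndepFun_iff_map_fun_eq_pi_map fun x => (hlaw x).aemeasurable).1 hind, expPi]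
  congr 1
  funext x
  exact (hlaw x).map_eq

theorem corollary1p8 (d : ℕ) (hd : 1 ≤ d) :
    ∃ c C : ℝ, 0 < c ∧ 0 < C ∧
      ∀ (n : ℕ), 1 ≤ n →
      ∀ (Ω : Type*) [MeasurableSpace Ω] (P : Measure Ω) [IsProbabilityMeasure P]
        (ξ : (Fin d → Fin n) → Ω → ℝ),
        (∀ x, HasLaw (ξ x) (expMeasure 1) P) →
        iIndepFun ξ P →
          Integrable (fun ω => minAxialWeight (fun x => ξ x ω)) P ∧
          c * (n : ℝ) ^ (-((d : ℤ) - 2)) ≤ ∫ ω, minAxialWeight (fun x => ξ x ω) ∂P ∧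
          ∫ ω, minAxialWeight (fun x => ξ x ω) ∂P ≤ C * (n : ℝ) ^ (-((d : ℤ) - 2)) := by
  obtain ⟨k, rfl⟩ : ∃ k, d = k + 1 := ⟨d - 1, by omega⟩
  -- 864 = 2 · 432: the factor 2 sums the geometric tail, and `Real.exp 1 ^ k` comes from κ =
  -- (n/e)^k.
  refine ⟨Real.exp (-1), 864 * Real.exp 1 ^ k, by positivity, by positivity, ?_⟩
  intro n hn Ω _ P _ ξ hlaw hind
  have hn0 : (n : ℝ) ≠ 0 := by exact_mod_cast (by omega : n ≠ 0)
  have hmap := map_eq_expPi hlaw hind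
  have hY : AEMeasurable (fun ω x => ξ x ω) P :=
    aemeasurable_pi_lambda _ fun x => (hlaw x).aemeasurable
  have hpow : (n : ℝ) ^ (-(((k + 1 : ℕ) : ℤ) - 2)) = n * ((n : ℝ) ^ k)⁻¹ := by
    rw [show -(((k + 1 : ℕ) : ℤ) - 2) = 1 + -(k : ℤ) by push_cast; ring, zpow_add₀ hn0, zpow_one,
      zpow_neg, zpow_natCast]
  have hint : ∫ ω, minAxialWeight (fun x => ξ x ω) ∂P =
      ∫ w, minAxialWeight w ∂expPi (Fin (k + 1) → Fin n) := by
    rw [← hmap, integral_map hY measurable_minAxialWeight.aestronglyMeasurable]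
  refine ⟨?_, ?_, ?_⟩
  · have h := integrable_minAxialWeight (k := k) hn
    rw [← hmap, integrable_map_measure measurable_minAxialWeight.aestronglyMeasurable hY] at h
    exact h
  · rw [hint, hpow]
    refine (le_of_eq ?_).trans (le_integral_minAxialWeight hn)
    ring
  · rw [hint, hpow]
    refine (integral_minAxialWeight_le hn).trans_eq ?_
    rw [div_pow]
    field_simp
    ring
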